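/- For $x\in[0,1)\setminus\mathbb{Q}$ let $x=[a_1(x),a_2(x),\dots]=\cfrac{1}{a_1(x)+\cfrac{1}{a_2(x)+\cdots}}$ be its continued fraction expansion with partial quotients $a_n(x)\in\mathbb{N}=\{1,2,\dots\}$; that is, $a_n(x)=\lfloor 1/T^{n-1}(x)\rfloor$, where $T(x)=1/x-\lfloor 1/x\rfloor$ is the Gauss map. For $n,\lambda\in\mathbb{N}$ let $$L_n(x,\lambda)=\max_{0\le j\le n-1}\ \sum_{k=1}^{n-j}\ \prod_{i=1}^{k}\mathbf 1_{a_{j+i}(x)=\lambda},\qquad R_n(x)=\max_{\lambda\in\mathbb{N}}L_n(x,\lambda),$$ so that $L_n(x,\lambda)$ is the length of the longest run of consecutive partial quotients equal to $\lambda$ among $a_1(x),\dots,a_n(x)$, and $R_n(x)$ is the length of the longest run of equal consecutive partial quotients among them. Put $\tau(\lambda)=\frac{\lambda+\sqrt{\lambda^2+4}}{2}$ and $\varphi=\frac{1+\sqrt5}{2}$. Then for every real $c>1/2$ and almost every $x\in[0,1)\setminus\mathbb{Q}$ with respect to the Gauss measure $\mathrm d\mu=\frac{1}{\log 2}\frac{\mathrm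 dx}{1+x}$ (equivalently, Lebesgue measure) the following two statements hold. (i) For every $\lambda\in\mathbb{N}$ there exists $n_0=n_0(c,x,\lambda)\in\mathbb{N}$ such that for all integers $n\ge n_0$, $$\left|L_n(x,\lambda)-\frac{\log n}{2\log\tau(\lambda)}\right|\le\frac{c\log\log n}{\log\tau(\lambda)}.$$ (ii) There exists $n_1=n_1(c,x)\in\mathbb{N}$ such that for all integers $n\ge n_1$, $$\left|R_n(x)-\frac{\log n}{2\log\varphi}\right|\le\frac{c\log\log n}{\log\varphi}.$$ -/

import Mathlib

open MeasureTheory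

namespace CFRuns

/-- The irrational points of the unit interval, `[0,1) \ ℚ`. -/
def unitIrrationals : Set ℝ := {x | x ∈ Set.Ico (0 : ℝ) 1 ∧ Irrational x}

/-- The Gauss map `T x = 1/x - ⌊1/x⌋`. -/
noncomputable def gaussMap (x : ℝ) : ℝ := 1 / x - (⌊1 / x⌋ : ℝ)

/-- The `n`-th partial quotient `a_n(x) = ⌊1 / T^{n-1}(x)⌋`, for `n ≥ 1`. -/
noncomputable def partialQuotient (n : ℕ) (x : ℝ) : ℕ := ⌊1 / (gaussMap^[n - 1] x)⌋₊

/-- The Gauss measure on `[0,1) \ ℚ`, with density `1 / (log 2 * (1 + x))`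
with respect to Lebesgue measure, as a measure on `ℝ` carried by that set. -/
noncomputable def gaussMeasure : Measure ℝ :=
  (volume.restrict unitIrrationals).withDensity
    (fun x => ENNReal.ofReal (1 / (Real.log 2 * (1 + x))))

/-- `L_n(x, d)`: the maximum over `0 ≤ j ≤ n - 1` of
`∑_{k=1}^{n-j} ∏_{i=1}^k 1_{a_{j+i}(x) = d}`, the length of the longest run of the
value `d` within the first `n` partial quotients of `x`. -/
noncomputable def longestRun (n : ℕ) (x : ℝ) (d : ℕ) : ℕ :=
  (Finset.range n).sup fun j =>
    ∑ k ∈ Finset.Icc 1 (n - j), ∏ i ∈ Finset.Icc 1 k,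
      if partialQuotient (j + i) x = d then 1 else 0

/-- `R_n(x)`: the maximum of `L_n(x, d)` over all positive integers `d`. -/
noncomputable def maxRun (n : ℕ) (x : ℝ) : ℕ := ⨆ d : ℕ+, longestRun n x d

theorem longestRun_le (n : ℕ) (x : ℝ) (d : ℕ) : longestRun n x d ≤ n := by
  refine Finset.sup_le fun j _ => ?_
  calc _ ≤ ∑ k ∈ Finset.Icc 1 (n - j), 1 := by
        refine Finset.sum_le_sum fun k _ => Finset.prod_le_one' fun i _ => ?_
        split_ifs <;> simp
    _ ≤ n := by simp

/-- The supremum defining `R_n(x)` is an attained maximum. -/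
theorem isGreatest_maxRun (n : ℕ) (x : ℝ) :
    IsGreatest (Set.range fun d : ℕ+ => longestRun n x d) (maxRun n x) := by
  have hb : BddAbove (Set.range fun d : ℕ+ => longestRun n x d) :=
    ⟨n, by rintro _ ⟨d, rfl⟩; exact longestRun_le n x d⟩
  exact ⟨Nat.sSup_mem (Set.range_nonempty _) hb, fun _ h => le_csSup hb h⟩

/-- `τ(d) = (d + √(d² + 4)) / 2`. -/
noncomputable def tau (d : ℕ) : ℝ := ((d : ℝ) + √((d : ℝ) ^ 2 + 4)) / 2

end CFRuns

namespace CFRuns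

open Set Filter
open scoped ENNReal Topology

/-! ### A family of probability measures stable under conditioning on the first digit -/

/-! The laws `tailLaw s`, 0 ≤ s ≤ 1, include Lebesgue measure (s = 0). Under `tailLaw s` the first
digit is d with probability `digitWeight s d`, and given this the tail has law `tailLaw (1 / (d +
s))`, again in the family. Bounds uniform in s thus pass through digits by induction, with no mixing
theorem.

An initial run of k digits d has probability between τ(d)^(-2k)/8 and 8 τ(d)^(-2k), thanks to an
explicit eigenfunction with eigenvalue τ(d)^(-2). A union bound gives P(L_n ≥ k) ≤ 8n τ^(-2k); n/k
disjoint blocks give P(L_n < k) ≤ (1 - τ^(-2k)/8)^(n/k).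

Let β = log τ and k ≈ (log n)/(2β) ± c(log log n)/β. Along n = 2^m the first bound is of order
m^(-2c) and the second at most exp(-K m^(2c-1)). Both are summable for c > 1/2, so Borel–Cantelli
applies, and monotonicity in n fills the gaps. For R_n, the upper bound survives summation over d at
the rate of φ = τ(1), and the digit 1 gives the lower bound. -/

/-- The density `(1 + s) / (1 + s t)²` of the conditional law of a tail of the expansion. -/
noncomputable def tailDensity (s t : ℝ) : ℝ := (1 + s) / (1 + s * t) ^ 2

/-- The law on `(0,1)` with density `tailDensity s`. -/
noncomputable def tailLaw (s : ℝ) : Measure ℝ :=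
  (volume.restrict (Ioo 0 1)).withDensity fun t => ENNReal.ofReal (tailDensity s t)

/-- The probability that the first digit is `d` under `tailLaw s`. -/
noncomputable def digitWeight (s : ℝ) (d : ℕ) : ℝ := (1 + s) / ((d + s) * (d + s + 1))

theorem measurable_tailDensity (s : ℝ) :
    Measurable fun t => ENNReal.ofReal (tailDensity s t) := by
  unfold tailDensity; fun_prop

theorem tailLaw_apply (s : ℝ) {A : Set ℝ} (hA : MeasurableSet A) :
    tailLaw s A = ∫⁻ t in A ∩ Ioo 0 1, ENNReal.ofReal (tailDensity s t) := by
  rw [tailLaw, withDensity_apply _ hA, Measure.restrict_restrict hA]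

theorem tailLaw_univ {s : ℝ} (hs : 0 ≤ s) : tailLaw s univ = 1 := by
  have hpos : ∀ t ∈ Icc (0 : ℝ) 1, 0 < 1 + s * t := fun t ht => by
    have := mul_nonneg hs ht.1; linarith
  have hcont : ContinuousOn (tailDensity s) (Icc 0 1) := by
    unfold tailDensity
    refine ContinuousOn.div (by fun_prop) (by fun_prop) fun t ht => ?_
    exact pow_ne_zero _ (hpos t ht).ne'
  have hint : ∫ t in (0 : ℝ)..1, tailDensity s t = 1 := by
    have hd : ∀ t ∈ uIcc (0 : ℝ) 1,
        -- The distribution function, equal to 0 at t = 0 and 1 at t = 1.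
        HasDerivAt (fun t => (1 + s) * t / (1 + s * t)) (tailDensity s t) t := fun t ht => by
      rw [uIcc_of_le zero_le_one] at ht
      have h1 : HasDerivAt (fun t => (1 + s) * t) (1 + s) t := by
        simpa using (hasDerivAt_id t).const_mul (1 + s)
      have h2 : HasDerivAt (fun t => 1 + s * t) s t := by
        simpa using ((hasDerivAt_id t).const_mul s).const_add 1
      refine (h1.div h2 (hpos t ht).ne').congr_deriv ?_
      unfold tailDensity
      congr 1
      ring
    rw [intervalIntegral.integral_eq_sub_of_hasDerivAt hd
      (by rw [← uIcc_of_le zero_le_one] at hcont; exact hcont.intervalIntegrable)]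
    have : (1 : ℝ) + s ≠ 0 := by linarith
    simp [this]
  have hi : IntegrableOn (tailDensity s) (Ioo 0 1) :=
    (hcont.integrableOn_Icc).mono_set Ioo_subset_Icc_self
  rw [tailLaw_apply s MeasurableSet.univ, univ_inter,
    ← ofReal_integral_eq_lintegral_ofReal hi]
  · rw [← integral_Ioc_eq_integral_Ioo, ← intervalIntegral.integral_of_le zero_le_one, hint,
      ENNReal.ofReal_one]
  · refine Eventually.of_forall fun t => ?_
    unfold tailDensity
    simp only [Pi.zero_apply]
    positivity

theorem tailLaw_congr (s : ℝ) {A B : Set ℝ} (h : ∀ t ∈ Ioo (0 : ℝ) 1, t ∈ A ↔ t ∈ B) :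
    tailLaw s A = tailLaw s B := by
  apply measure_congr
  have : ∀ᵐ t ∂(tailLaw s), t ∈ Ioo (0 : ℝ) 1 :=
    (withDensity_absolutelyContinuous _ _).ae_le (ae_restrict_mem measurableSet_Ioo)
  filter_upwards [this] with t ht
  exact propext (h t ht)

theorem image_one_div_add (d : ℕ) (hd : 1 ≤ d) (A : Set ℝ) :
    (fun t : ℝ => 1 / (d + t)) '' ((fun t : ℝ => 1 / (d + t)) ⁻¹' A ∩ Ioo 0 1) =
      A ∩ Ioo (1 / ((d : ℝ) + 1)) (1 / d) := by
  have hd' : (1 : ℝ) ≤ d := by exact_mod_cast hd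
  ext x
  constructor
  · rintro ⟨t, ⟨hA, h0, h1⟩, rfl⟩
    refine ⟨hA, ?_, ?_⟩
    · exact one_div_lt_one_div_of_lt (by linarith) (by linarith)
    · exact one_div_lt_one_div_of_lt (by linarith) (by linarith)
  · rintro ⟨hA, h0, h1⟩
    have hx : 0 < x := lt_trans (by positivity) h0
    rw [div_lt_iff₀ (by linarith)] at h0
    rw [lt_div_iff₀ (by linarith)] at h1
    have e : 1 / ((d : ℝ) + (1 / x - d)) = x := by simp
    refine ⟨1 / x - d, ⟨by simpa only [mem_preimage, e] using hA, ?_, ?_⟩, e⟩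
    · rw [sub_pos, lt_div_iff₀ hx]; linarith
    · rw [sub_lt_iff_lt_add, div_lt_iff₀ hx]; linarith

/-- Substituting x = 1/(d + t), the Jacobian (d + t)⁻² cancels the denominators, leaving a constant
times the density with parameter 1/(d + s). -/
theorem setLIntegral_digit {s : ℝ} (hs : 0 ≤ s) (d : ℕ) (hd : 1 ≤ d) {A : Set ℝ}
    (hA : MeasurableSet A) :
    ∫⁻ x in A ∩ Ioo (1 / ((d : ℝ) + 1)) (1 / d), ENNReal.ofReal (tailDensity s x) =
      ENNReal.ofReal (digitWeight s d) *
        tailLaw (1 / (d + s)) ((fun t : ℝ => 1 / (d + t)) ⁻¹' A) := by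
  have hd' : (1 : ℝ) ≤ d := by exact_mod_cast hd
  have hm : Measurable fun t : ℝ => 1 / ((d : ℝ) + t) := by fun_prop
  rw [tailLaw_apply _ (hm hA), ← image_one_div_add d hd A,
    lintegral_image_eq_lintegral_abs_deriv_mul (f' := fun t => -1 / ((d : ℝ) + t) ^ 2)
      ((hm hA).inter measurableSet_Ioo), ← lintegral_const_mul _ (measurable_tailDensity _)]
  · refine setLIntegral_congr_fun ((hm hA).inter measurableSet_Ioo) fun t ht => ?_
    have ht0 : 0 < t := ht.2.1
    rw [← ENNReal.ofReal_mul (abs_nonneg _), ← ENNReal.ofReal_mul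
      (by unfold digitWeight; positivity)]
    congr 1
    unfold tailDensity digitWeight
    rw [neg_div, abs_neg, abs_of_pos (by positivity)]
    have h1 : (d : ℝ) + t ≠ 0 := by positivity
    have h2 : (d : ℝ) + s ≠ 0 := by positivity
    have h3 : (d : ℝ) + s + 1 ≠ 0 := by positivity
    have h4 : (d : ℝ) + t + s ≠ 0 := by positivity
    have e1 : 1 + s * (1 / ((d : ℝ) + t)) = (d + t + s) / (d + t) := by field_simp
    have e2 : 1 + 1 / ((d : ℝ) + s) * t = (d + t + s) / (d + s) := by field_simp; ring
    rw [e1, e2]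
    field_simp
  · intro t ht
    have ht0 : 0 < t := ht.2.1
    have h : HasDerivAt (fun t : ℝ => ((d : ℝ) + t)⁻¹) (-1 / ((d : ℝ) + t) ^ 2) t :=
      ((hasDerivAt_id t).const_add (d : ℝ)).inv (by simp only [id]; positivity)
    simp only [one_div]
    exact h.hasDerivWithinAt
  · intro t ht u hu h
    have ht0 : 0 < t := ht.2.1
    have hu0 : 0 < u := hu.2.1
    simp only [one_div, inv_inj] at h
    linarith

/-- Conditioning on the first digit. -/
theorem tailLaw_eq_tsum {s : ℝ} (hs : 0 ≤ s) {A : Set ℝ} (hA : MeasurableSet A) :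
    tailLaw s A = ∑' n : ℕ, ENNReal.ofReal (digitWeight s (n + 1)) *
      tailLaw (1 / ((n + 1 : ℕ) + s)) ((fun t : ℝ => 1 / ((n + 1 : ℕ) + t)) ⁻¹' A) := by
  set I : ℕ → Set ℝ := fun n => Ioo (1 / (((n + 1 : ℕ) : ℝ) + 1)) (1 / ((n + 1 : ℕ) : ℝ))
  have hmem : ∀ n x, x ∈ I n → 0 < x ∧ ((n + 1 : ℕ) : ℝ) < 1 / x ∧ 1 / x < (n + 1 : ℕ) + 1 := by
    rintro n x ⟨h0, h1⟩
    have hx : 0 < x := lt_trans (by positivity) h0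
    rw [div_lt_iff₀ (by positivity)] at h0
    rw [lt_div_iff₀ (by positivity)] at h1
    refine ⟨hx, ?_, ?_⟩
    · rw [lt_div_iff₀ hx]; linarith
    · rw [div_lt_iff₀ hx]; linarith
  have hdisj : Pairwise (Function.onFun Disjoint fun n => A ∩ I n) := by
    intro m n hmn
    refine Set.disjoint_left.2 fun x hx hy => hmn ?_
    obtain ⟨-, h1, h2⟩ := hmem m x hx.2
    obtain ⟨-, h3, h4⟩ := hmem n x hy.2
    have h5 : m + 1 < n + 1 + 1 := by exact_mod_cast h1.trans h4
    have h6 : n + 1 < m + 1 + 1 := by exact_mod_cast h3.trans h2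
    omega
  -- The open digit intervals miss only the countably many reciprocals of integers.
  have hcover : (A ∩ Ioo (0 : ℝ) 1 : Set ℝ) =ᵐ[volume] ⋃ n, A ∩ I n := by
    have hc : (range fun n : ℕ => (1 / (n : ℝ))).Countable := countable_range _
    filter_upwards [hc.ae_notMem volume] with x hx
    refine propext ⟨fun ⟨hxA, h0, h1⟩ => ?_, fun h => ?_⟩
    · have h1x : 1 < 1 / x := by rwa [lt_div_iff₀ h0, one_mul]
      have hfl : 1 ≤ ⌊1 / x⌋₊ := Nat.le_floor (by simpa using h1x.le)
      have hle : (⌊1 / x⌋₊ : ℝ) ≤ 1 / x := Nat.floor_le (by positivity)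
      have hne : (⌊1 / x⌋₊ : ℝ) ≠ 1 / x := fun h => hx ⟨⌊1 / x⌋₊, by simp only [h]; simp⟩
      have hlt : 1 / x < ⌊1 / x⌋₊ + 1 := Nat.lt_floor_add_one _
      obtain ⟨n, hn⟩ : ∃ n, ⌊1 / x⌋₊ = n + 1 := ⟨_, (Nat.sub_add_cancel hfl).symm⟩
      rw [hn] at hle hne hlt
      refine mem_iUnion.2 ⟨n, hxA, ?_, ?_⟩
      · rw [div_lt_iff₀ (by positivity)]; rw [div_lt_iff₀ h0] at hlt; linarith
      · have := lt_of_le_of_ne hle hne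
        rw [lt_div_iff₀ h0] at this
        rw [lt_div_iff₀ (by positivity)]; linarith
    · obtain ⟨n, hxA, hxI⟩ := mem_iUnion.1 h
      obtain ⟨h0, h1, -⟩ := hmem n x hxI
      refine ⟨hxA, h0, ?_⟩
      rw [lt_div_iff₀ h0] at h1
      have : (1 : ℝ) ≤ (n + 1 : ℕ) := by push_cast; linarith [Nat.cast_nonneg (α := ℝ) n]
      nlinarith
  rw [tailLaw_apply s hA, setLIntegral_congr hcover,
    lintegral_iUnion (fun n => hA.inter measurableSet_Ioo) hdisj]
  exact tsum_congr fun n => setLIntegral_digit hs (n + 1) (by omega) hA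

theorem tsum_digitWeight {s : ℝ} (hs : 0 ≤ s) :
    ∑' n : ℕ, ENNReal.ofReal (digitWeight s (n + 1)) = 1 := by
  have h := tailLaw_eq_tsum hs MeasurableSet.univ
  rw [tailLaw_univ hs] at h
  rw [h]
  refine tsum_congr fun n => ?_
  rw [preimage_univ, tailLaw_univ (by positivity), mul_one]

/-! ### Runs at the beginning of the expansion -/

theorem measurable_gaussMap : Measurable gaussMap := by
  unfold gaussMap
  have h : Measurable fun x : ℝ => 1 / x := by fun_prop
  exact h.sub (measurable_from_top.comp (Int.measurable_floor.comp h))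

theorem gaussMap_one_div {d : ℕ} {t : ℝ} (ht : t ∈ Ioo (0 : ℝ) 1) :
    gaussMap (1 / (d + t)) = t := by
  have : ⌊t⌋ = 0 := Int.floor_eq_zero_iff.2 ⟨ht.1.le, ht.2⟩
  simp [gaussMap, this]

theorem floor_one_div {d : ℕ} {t : ℝ} (ht : t ∈ Ioo (0 : ℝ) 1) :
    ⌊1 / (1 / ((d : ℝ) + t))⌋₊ = d := by
  rw [one_div_one_div, add_comm, Nat.floor_add_natCast ht.1.le,
    Nat.floor_eq_zero.2 ht.2, zero_add]

/-- The points whose first `k` digits all equal `d`. -/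
def initialRun (d k : ℕ) : Set ℝ := {x | ∀ i < k, ⌊1 / gaussMap^[i] x⌋₊ = d}

theorem measurableSet_initialRun (d k : ℕ) : MeasurableSet (initialRun d k) := by
  have h : initialRun d k = ⋂ i, ⋂ (_ : i < k),
      (fun x => ⌊1 / gaussMap^[i] x⌋₊) ⁻¹' {d} := by
    ext x; simp [initialRun]
  rw [h]
  refine MeasurableSet.iInter fun i => MeasurableSet.iInter fun _ => ?_
  have hm : Measurable fun x => 1 / gaussMap^[i] x :=
    (measurable_gaussMap.iterate i).const_div 1
  exact (Nat.measurable_floor.comp hm) (measurableSet_singleton d)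

theorem initialRun_zero (d : ℕ) : initialRun d 0 = univ := by simp [initialRun]

theorem initialRun_anti (d : ℕ) : Antitone (initialRun d) :=
  fun _ _ h _ hx i hi => hx i (hi.trans_le h)

theorem mem_initialRun_succ (d k : ℕ) (x : ℝ) :
    x ∈ initialRun d (k + 1) ↔ ⌊1 / x⌋₊ = d ∧ gaussMap x ∈ initialRun d k := by
  simp only [initialRun, mem_ofPred_eq]
  constructor
  · exact fun h => ⟨h 0 (by omega), fun i hi => h (i + 1) (by omega)⟩
  · rintro ⟨h0, h⟩ (_ | i) hi
    · exact h0
    · exact h i (by omega)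

theorem one_div_mem_initialRun_succ {d e k : ℕ} {t : ℝ} (ht : t ∈ Ioo (0 : ℝ) 1) :
    1 / ((e : ℝ) + t) ∈ initialRun d (k + 1) ↔ e = d ∧ t ∈ initialRun d k := by
  rw [mem_initialRun_succ, floor_one_div ht, gaussMap_one_div ht]

theorem one_div_add_mem_Icc {s : ℝ} (hs : 0 ≤ s) {d : ℕ} (hd : 1 ≤ d) :
    1 / ((d : ℝ) + s) ∈ Icc (0 : ℝ) 1 := by
  have hd' : (1 : ℝ) ≤ d := by exact_mod_cast hd
  refine ⟨by positivity, ?_⟩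
  rw [div_le_one (by positivity)]
  linarith

theorem tailLaw_initialRun_succ {s : ℝ} (hs : 0 ≤ s) {d : ℕ} (hd : 1 ≤ d) (k : ℕ) :
    tailLaw s (initialRun d (k + 1)) =
      ENNReal.ofReal (digitWeight s d) * tailLaw (1 / (d + s)) (initialRun d k) := by
  rw [tailLaw_eq_tsum hs (measurableSet_initialRun _ _), tsum_eq_single (d - 1)]
  · rw [Nat.sub_add_cancel hd]
    congr 1
    exact tailLaw_congr _ fun t ht => by
      rw [mem_preimage, one_div_mem_initialRun_succ ht]; simp
  · intro n hn
    rw [tailLaw_congr (B := ∅), measure_empty, mul_zero]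
    intro t ht
    rw [mem_preimage, one_div_mem_initialRun_succ ht]
    simp only [mem_empty_iff_false, iff_false, not_and]
    intro h
    omega

/-- Shifts do not increase uniform bounds on measures. -/
theorem tailLaw_preimage_iterate_le {B : Set ℝ} (hB : MeasurableSet B) {M : ℝ≥0∞}
    (h : ∀ s ∈ Icc (0 : ℝ) 1, tailLaw s B ≤ M) (j : ℕ) :
    ∀ s ∈ Icc (0 : ℝ) 1, tailLaw s (gaussMap^[j] ⁻¹' B) ≤ M := by
  induction j with
  | zero => exact h
  | succ j ih =>
    intro s hs
    rw [tailLaw_eq_tsum hs.1 (measurable_gaussMap.iterate _ hB)]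
    calc _ ≤ ∑' n : ℕ, ENNReal.ofReal (digitWeight s (n + 1)) * M := by
          refine ENNReal.tsum_le_tsum fun n => mul_le_mul_right ?_ _
          rw [tailLaw_congr (B := gaussMap^[j] ⁻¹' B)]
          · exact ih _ (one_div_add_mem_Icc hs.1 (by omega))
          · intro t ht
            simp only [mem_preimage, Function.iterate_succ_apply, gaussMap_one_div ht]
      _ = M := by rw [ENNReal.tsum_mul_right, tsum_digitWeight hs.1, one_mul]

/-- Substitute for independence: missing the run and then landing in G has probability at most (1 -
P(run)) M. In the induction, a first digit other than d already breaks the run, so only the shift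
bound is needed; a first digit d leaves a run of length k. The additive form avoids truncated
subtraction. -/
theorem tailLaw_compl_initialRun_inter_add_le {d k : ℕ} {G : Set ℝ}
    (hG : MeasurableSet G) {M : ℝ≥0∞} (h : ∀ s ∈ Icc (0 : ℝ) 1, tailLaw s G ≤ M) :
    ∀ s ∈ Icc (0 : ℝ) 1, tailLaw s ((initialRun d k)ᶜ ∩ gaussMap^[k] ⁻¹' G) +
      tailLaw s (initialRun d k) * M ≤ M := by
  induction k with
  | zero =>
    intro s hs
    simp [initialRun_zero, tailLaw_univ hs.1]
  | succ k ih =>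
    intro s hs
    rw [tailLaw_eq_tsum hs.1 ((measurableSet_initialRun _ _).compl.inter
        (measurable_gaussMap.iterate _ hG)),
      tailLaw_eq_tsum hs.1 (measurableSet_initialRun _ _), ← ENNReal.tsum_mul_right,
      ← ENNReal.tsum_add]
    calc _ ≤ ∑' n : ℕ, ENNReal.ofReal (digitWeight s (n + 1)) * M := by
          refine ENNReal.tsum_le_tsum fun n => ?_
          rw [mul_assoc, ← mul_add]
          refine mul_le_mul_right ?_ _
          have hs' := one_div_add_mem_Icc hs.1 (d := n + 1) (by omega)
          by_cases hn : n + 1 = d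
          · rw [tailLaw_congr (B := (initialRun d k)ᶜ ∩ gaussMap^[k] ⁻¹' G),
              tailLaw_congr (A := _ ⁻¹' initialRun d (k + 1)) (B := initialRun d k)]
            · exact ih _ hs'
            · intro t ht
              rw [mem_preimage, one_div_mem_initialRun_succ ht]
              simp [hn]
            · intro t ht
              rw [mem_preimage, mem_inter_iff, mem_compl_iff, one_div_mem_initialRun_succ ht]
              simp only [mem_preimage, Function.iterate_succ_apply, gaussMap_one_div ht]
              simp [hn]
          · rw [tailLaw_congr (A := _ ⁻¹' initialRun d (k + 1)) (B := ∅), measure_empty,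
              zero_mul, add_zero, tailLaw_congr (B := gaussMap^[k] ⁻¹' G)]
            · exact tailLaw_preimage_iterate_le hG h k _ hs'
            · intro t ht
              rw [mem_preimage, mem_inter_iff, mem_compl_iff, one_div_mem_initialRun_succ ht]
              simp only [mem_preimage, Function.iterate_succ_apply, gaussMap_one_div ht]
              simp [hn]
            · intro t ht
              rw [mem_preimage, one_div_mem_initialRun_succ ht]
              simp [hn]
      _ = M := by rw [ENNReal.tsum_mul_right, tsum_digitWeight hs.1, one_mul]

/-! ### The measure of the runs -/

theorem tau_sq (d : ℕ) : tau d ^ 2 = d * tau d + 1 := by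
  have h : √((d : ℝ) ^ 2 + 4) ^ 2 = (d : ℝ) ^ 2 + 4 := Real.sq_sqrt (by positivity)
  unfold tau
  linear_combination h / 4

theorem tau_one : tau 1 = Real.goldenRatio := by
  unfold tau Real.goldenRatio
  norm_num

theorem le_tau (d : ℕ) : (d : ℝ) ≤ tau d := by
  have h : (d : ℝ) ≤ √((d : ℝ) ^ 2 + 4) := Real.le_sqrt_of_sq_le (by linarith)
  unfold tau
  linarith

theorem goldenRatio_le_tau {d : ℕ} (hd : 1 ≤ d) : Real.goldenRatio ≤ tau d := by
  have hd' : (1 : ℝ) ≤ d := by exact_mod_cast hd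
  rw [← tau_one]
  unfold tau
  have h : √(((1 : ℕ) : ℝ) ^ 2 + 4) ≤ √((d : ℝ) ^ 2 + 4) := by
    apply Real.sqrt_le_sqrt
    push_cast
    nlinarith
  exact div_le_div_of_nonneg_right (add_le_add (by exact_mod_cast hd) h) two_pos.le

theorem one_lt_tau {d : ℕ} (hd : 1 ≤ d) : 1 < tau d :=
  Real.one_lt_goldenRatio.trans_le (goldenRatio_le_tau hd)

/-- An eigenfunction, for the eigenvalue `τ⁻²`, of conditioning on the first digit being `d`. -/
noncomputable def runEigenfunction (d : ℕ) (s : ℝ) : ℝ := (1 + s) / (s + tau d) ^ 2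

/-- Up to the factor τ⁻², the eigenfunction is `tailDensity s` at 1/τ = [d, d, …], the fixed point
of t ↦ 1/(d + t). The change of variables for the digit d, evaluated there, has Jacobian τ⁻². -/
theorem digitWeight_mul_runEigenfunction {d : ℕ} (hd : 1 ≤ d) {s : ℝ} (hs : 0 ≤ s) :
    digitWeight s d * runEigenfunction d (1 / (d + s)) =
      (tau d ^ 2)⁻¹ * runEigenfunction d s := by
  have hd' : (1 : ℝ) ≤ d := by exact_mod_cast hd
  have ht : 0 < tau d := zero_lt_one.trans (one_lt_tau hd)
  have h2 : (d : ℝ) + s ≠ 0 := by positivity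
  have e : 1 / ((d : ℝ) + s) + tau d = tau d * (s + tau d) / (d + s) := by
    field_simp
    linear_combination -tau_sq d
  have e' : 1 + 1 / ((d : ℝ) + s) = (d + s + 1) / (d + s) := by field_simp
  unfold digitWeight runEigenfunction
  rw [e, e']
  field_simp

theorem runEigenfunction_le {d : ℕ} (hd : 1 ≤ d) {s : ℝ} (hs : s ∈ Icc (0 : ℝ) 1) :
    runEigenfunction d s ≤ 2 / tau d ^ 2 := by
  have ht : 0 < tau d := zero_lt_one.trans (one_lt_tau hd)
  have h0 := hs.1
  unfold runEigenfunction
  gcongr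
  · linarith [hs.2]
  · linarith

theorem le_runEigenfunction {d : ℕ} (hd : 1 ≤ d) {s : ℝ} (hs : s ∈ Icc (0 : ℝ) 1) :
    1 / (1 + tau d) ^ 2 ≤ runEigenfunction d s := by
  have ht : 0 < tau d := zero_lt_one.trans (one_lt_tau hd)
  have h0 := hs.1
  unfold runEigenfunction
  gcongr
  · linarith
  · exact hs.2

theorem tailLaw_initialRun_le {d : ℕ} (hd : 1 ≤ d) (k : ℕ) {s : ℝ} (hs : s ∈ Icc (0 : ℝ) 1) :
    tailLaw s (initialRun d k) ≤ ENNReal.ofReal (8 * (tau d ^ 2)⁻¹ ^ k) := by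
  have ht := one_lt_tau hd
  -- The factor (1 + τ)² normalizes the eigenfunction to be at least 1, as k = 0 requires; the
  -- recursion then preserves the bound.
  have key : ∀ s ∈ Icc (0 : ℝ) 1, tailLaw s (initialRun d k) ≤
      ENNReal.ofReal ((1 + tau d) ^ 2 * ((tau d ^ 2)⁻¹ ^ k * runEigenfunction d s)) := by
    induction k with
    | zero =>
      intro s hs
      rw [initialRun_zero, tailLaw_univ hs.1, ENNReal.one_le_ofReal, pow_zero, one_mul,
        ← div_le_iff₀' (by positivity)]
      exact le_runEigenfunction hd hs
    | succ k ih =>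
      intro s hs
      have hw : 0 ≤ digitWeight s d := by
        have := hs.1
        unfold digitWeight; positivity
      rw [tailLaw_initialRun_succ hs.1 hd]
      refine (mul_le_mul_right (ih _ (one_div_add_mem_Icc hs.1 hd)) _).trans_eq ?_
      rw [← ENNReal.ofReal_mul hw]
      congr 1
      linear_combination (1 + tau d) ^ 2 * (tau d ^ 2)⁻¹ ^ k *
        digitWeight_mul_runEigenfunction hd hs.1
  refine (key s hs).trans (ENNReal.ofReal_le_ofReal ?_)
  calc _ ≤ (1 + tau d) ^ 2 * ((tau d ^ 2)⁻¹ ^ k * (2 / tau d ^ 2)) := by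
        gcongr
        exact runEigenfunction_le hd hs
    _ = 2 * ((1 + tau d) ^ 2 / tau d ^ 2) * (tau d ^ 2)⁻¹ ^ k := by ring
    _ ≤ 2 * 4 * (tau d ^ 2)⁻¹ ^ k := by
        gcongr
        rw [div_le_iff₀ (by positivity)]
        nlinarith
    _ = _ := by ring

theorem le_tailLaw_initialRun {d : ℕ} (hd : 1 ≤ d) (k : ℕ) {s : ℝ} (hs : s ∈ Icc (0 : ℝ) 1) :
    ENNReal.ofReal (1 / 8 * (tau d ^ 2)⁻¹ ^ k) ≤ tailLaw s (initialRun d k) := by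
  have ht := one_lt_tau hd
  -- Here τ²/2 normalizes the eigenfunction to be at most 1.
  have key : ∀ s ∈ Icc (0 : ℝ) 1,
      ENNReal.ofReal (tau d ^ 2 / 2 * ((tau d ^ 2)⁻¹ ^ k * runEigenfunction d s)) ≤
        tailLaw s (initialRun d k) := by
    induction k with
    | zero =>
      intro s hs
      rw [initialRun_zero, tailLaw_univ hs.1, ENNReal.ofReal_le_one, pow_zero, one_mul]
      calc _ ≤ tau d ^ 2 / 2 * (2 / tau d ^ 2) := by
            gcongr
            exact runEigenfunction_le hd hs
        _ = 1 := by field_simp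
    | succ k ih =>
      intro s hs
      have hw : 0 ≤ digitWeight s d := by
        have := hs.1
        unfold digitWeight; positivity
      rw [tailLaw_initialRun_succ hs.1 hd]
      refine le_trans (le_of_eq ?_) (mul_le_mul_right (ih _ (one_div_add_mem_Icc hs.1 hd)) _)
      rw [← ENNReal.ofReal_mul hw]
      congr 1
      linear_combination -(tau d ^ 2 / 2 * (tau d ^ 2)⁻¹ ^ k *
        digitWeight_mul_runEigenfunction hd hs.1)
  refine (ENNReal.ofReal_le_ofReal ?_).trans (key s hs)
  have hfrac : 1 / 4 ≤ tau d ^ 2 / (1 + tau d) ^ 2 := by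
    rw [div_le_div_iff₀ (by norm_num) (by positivity)]
    nlinarith
  calc _ = 1 / 2 * (1 / 4) * (tau d ^ 2)⁻¹ ^ k := by ring
    _ ≤ 1 / 2 * (tau d ^ 2 / (1 + tau d) ^ 2) * (tau d ^ 2)⁻¹ ^ k :=
        mul_le_mul_of_nonneg_right (by linarith) (by positivity)
    _ = tau d ^ 2 / 2 * ((tau d ^ 2)⁻¹ ^ k * (1 / (1 + tau d) ^ 2)) := by ring
    _ ≤ _ := by
        gcongr
        exact le_runEigenfunction hd hs

/-- The points having no run of `d` at any of the positions `0, k, …, (m - 1) k`. -/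
def noBlockRun (d k m : ℕ) : Set ℝ := {x | ∀ i < m, gaussMap^[i * k] x ∉ initialRun d k}

theorem noBlockRun_succ (d k m : ℕ) :
    noBlockRun d k (m + 1) = (initialRun d k)ᶜ ∩ gaussMap^[k] ⁻¹' noBlockRun d k m := by
  ext x
  simp only [noBlockRun, mem_ofPred_eq, mem_inter_iff, mem_compl_iff, mem_preimage,
    ← Function.iterate_add_apply]
  constructor
  · intro h
    refine ⟨by simpa using h 0 (by omega), fun i hi => ?_⟩
    have := h (i + 1) (by omega)
    rwa [add_mul, one_mul] at this
  · rintro ⟨h0, h⟩ (_ | i) hi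
    · simpa using h0
    · have := h i (by omega)
      rwa [add_mul, one_mul]

theorem measurableSet_noBlockRun (d k m : ℕ) : MeasurableSet (noBlockRun d k m) := by
  induction m with
  | zero => simp [noBlockRun]
  | succ m ih =>
    rw [noBlockRun_succ]
    exact (measurableSet_initialRun d k).compl.inter (measurable_gaussMap.iterate k ih)

theorem tailLaw_noBlockRun_le {d : ℕ} (hd : 1 ≤ d) (k m : ℕ) :
    ∀ s ∈ Icc (0 : ℝ) 1, tailLaw s (noBlockRun d k m) ≤
      ENNReal.ofReal ((1 - 1 / 8 * (tau d ^ 2)⁻¹ ^ k) ^ m) := by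
  have ht := one_lt_tau hd
  have hp : 0 ≤ 1 / 8 * (tau d ^ 2)⁻¹ ^ k := by positivity
  have hle : 1 / 8 * (tau d ^ 2)⁻¹ ^ k ≤ 1 := by
    have : (tau d ^ 2)⁻¹ ^ k ≤ 1 := pow_le_one₀ (by positivity)
      (inv_le_one_of_one_le₀ (by nlinarith))
    linarith
  induction m with
  | zero =>
    intro s hs
    simp [noBlockRun, tailLaw_univ hs.1]
  | succ m ih =>
    intro s hs
    set M := (1 - 1 / 8 * (tau d ^ 2)⁻¹ ^ k) ^ m with hM
    have hM0 : 0 ≤ M := pow_nonneg (by linarith) _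
    have h := tailLaw_compl_initialRun_inter_add_le (d := d) (k := k)
      (measurableSet_noBlockRun d k m) ih s hs
    rw [← noBlockRun_succ] at h
    have h' : tailLaw s (noBlockRun d k (m + 1)) +
        ENNReal.ofReal (1 / 8 * (tau d ^ 2)⁻¹ ^ k * M) ≤ ENNReal.ofReal M := by
      rw [ENNReal.ofReal_mul hp]
      exact (add_le_add_right (mul_le_mul_left (le_tailLaw_initialRun hd k hs) _) _).trans h
    refine (ENNReal.le_sub_of_add_le_right ENNReal.ofReal_ne_top h').trans_eq ?_
    rw [← ENNReal.ofReal_sub _ (by positivity), pow_succ]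
    congr 1
    ring

/-! ### Longest runs -/

open scoped Classical in
theorem prod_digit_eq (j k d : ℕ) (x : ℝ) :
    (∏ i ∈ Finset.Icc 1 k, if partialQuotient (j + i) x = d then 1 else 0) =
      if gaussMap^[j] x ∈ initialRun d k then (1 : ℕ) else 0 := by
  -- Partial quotients are numbered from 1, iterates of the Gauss map from 0.
  have hq : ∀ i, partialQuotient (j + (i + 1)) x = ⌊1 / gaussMap^[i] (gaussMap^[j] x)⌋₊ := by
    intro i
    rw [partialQuotient, ← Function.iterate_add_apply, ← add_assoc, Nat.add_sub_cancel, add_comm]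
  split_ifs with h
  · refine Finset.prod_eq_one fun i hi => ?_
    obtain ⟨h1, h2⟩ := Finset.mem_Icc.1 hi
    obtain ⟨i, rfl⟩ : ∃ l, i = l + 1 := ⟨i - 1, by omega⟩
    rw [hq, if_pos (h i (by omega))]
  · simp only [initialRun, mem_ofPred_eq, not_forall] at h
    obtain ⟨i, hi, hne⟩ := h
    refine Finset.prod_eq_zero (i := i + 1) (Finset.mem_Icc.2 (by omega)) ?_
    rw [hq, if_neg hne]

/-- As `initialRun d` is antitone in the length, the inner sum counts an initial segment of lengths,
so it is the length of the run starting at j, cut off at n. -/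
theorem le_longestRun_iff {n k d : ℕ} (hk : 1 ≤ k) (x : ℝ) :
    k ≤ longestRun n x d ↔ ∃ j, j + k ≤ n ∧ gaussMap^[j] x ∈ initialRun d k := by
  classical
  rw [longestRun, Finset.le_sup_iff (show ⊥ < k from hk)]
  simp only [prod_digit_eq, Finset.sum_boole, Nat.cast_id, Finset.mem_range]
  constructor
  · rintro ⟨j, -, hc⟩
    by_contra! hno
    have hsub : (Finset.Icc 1 (n - j)).filter (fun l => gaussMap^[j] x ∈ initialRun d l) ⊆
        Finset.Icc 1 (k - 1) := by
      intro l hl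
      obtain ⟨hl1, hl2⟩ := Finset.mem_filter.1 hl
      rw [Finset.mem_Icc] at hl1 ⊢
      refine ⟨hl1.1, ?_⟩
      by_contra! hlt
      exact hno j (by omega) (initialRun_anti d (by omega) hl2)
    have := hc.trans (Finset.card_le_card hsub)
    simp only [Nat.card_Icc] at this
    omega
  · rintro ⟨j, hj, hx⟩
    refine ⟨j, by omega, ?_⟩
    have hsub : Finset.Icc 1 k ⊆
        (Finset.Icc 1 (n - j)).filter (fun l => gaussMap^[j] x ∈ initialRun d l) := by
      intro l hl
      rw [Finset.mem_Icc] at hl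
      refine Finset.mem_filter.2 ⟨Finset.mem_Icc.2 (by omega), initialRun_anti d hl.2 hx⟩
    simpa using Finset.card_le_card hsub

theorem longestRun_mono (x : ℝ) (d : ℕ) : Monotone fun n => longestRun n x d := by
  intro m n hmn
  simp only
  rcases Nat.eq_zero_or_pos (longestRun m x d) with h | h
  · omega
  · obtain ⟨j, hj, hx⟩ := (le_longestRun_iff h x).1 le_rfl
    exact (le_longestRun_iff h x).2 ⟨j, hj.trans hmn, hx⟩

theorem longestRun_le_maxRun (n : ℕ) (x : ℝ) {d : ℕ} (hd : 1 ≤ d) :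
    longestRun n x d ≤ maxRun n x :=
  (isGreatest_maxRun n x).2 ⟨⟨d, hd⟩, rfl⟩

theorem maxRun_mono (x : ℝ) : Monotone fun n => maxRun n x := by
  intro m n hmn
  obtain ⟨d, hd⟩ := (isGreatest_maxRun m x).1
  simp only at hd ⊢
  rw [← hd]
  exact (longestRun_mono x d hmn).trans (longestRun_le_maxRun n x d.2)

/-! ### Tail estimates for the longest runs -/

theorem inv_sq_pow_eq_exp {a : ℝ} (ha : 0 < a) (k : ℕ) :
    (a ^ 2)⁻¹ ^ k = Real.exp (-(2 * Real.log a * k)) := by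
  rw [Real.exp_neg, mul_comm _ (k : ℝ), Real.exp_nat_mul, mul_comm 2, Real.exp_mul,
    Real.exp_log ha, inv_pow]
  norm_cast

theorem tailLaw_le_longestRun {d : ℕ} (hd : 1 ≤ d) (n : ℕ) {k : ℕ} (hk : 1 ≤ k) :
    tailLaw 0 {x | k ≤ longestRun n x d} ≤
      ENNReal.ofReal (8 * n * (tau d ^ 2)⁻¹ ^ k) := by
  have hsub : {x | k ≤ longestRun n x d} ⊆
      ⋃ j ∈ Finset.range n, gaussMap^[j] ⁻¹' initialRun d k := by
    intro x hx
    obtain ⟨j, hj, hx⟩ := (le_longestRun_iff hk x).1 hx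
    simp only [Finset.mem_range, mem_iUnion]
    exact ⟨j, by omega, hx⟩
  refine (measure_mono hsub).trans ((measure_biUnion_finset_le _ _).trans ?_)
  calc _ ≤ ∑ j ∈ Finset.range n, ENNReal.ofReal (8 * (tau d ^ 2)⁻¹ ^ k) :=
        Finset.sum_le_sum fun j _ => tailLaw_preimage_iterate_le (measurableSet_initialRun d k)
          (fun s hs => tailLaw_initialRun_le hd k hs) j 0 (by simp)
    _ = _ := by
        rw [Finset.sum_const, Finset.card_range, nsmul_eq_mul, ← ENNReal.ofReal_natCast,
          ← ENNReal.ofReal_mul (by positivity)]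
        congr 1
        ring

theorem tailLaw_longestRun_lt {d : ℕ} (hd : 1 ≤ d) (n k : ℕ) :
    tailLaw 0 {x | longestRun n x d < k} ≤ ENNReal.ofReal
      (Real.exp (-(1 / 8 * Real.exp (-(2 * Real.log (tau d) * k)) * (n / k : ℕ)))) := by
  have ht := one_lt_tau hd
  rcases Nat.eq_zero_or_pos k with rfl | hk
  · simp
  -- A full block among the n / k disjoint ones would be a run of length k.
  have hsub : {x | longestRun n x d < k} ⊆ noBlockRun d k (n / k) := by
    intro x hx i hi hrun
    refine absurd ((le_longestRun_iff hk x).2 ⟨i * k, ?_, hrun⟩) (not_le.2 hx)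
    calc i * k + k = (i + 1) * k := by ring
      _ ≤ n / k * k := Nat.mul_le_mul_right _ hi
      _ ≤ n := Nat.div_mul_le_self n k
  refine (measure_mono hsub).trans ((tailLaw_noBlockRun_le hd k _ 0 (by simp)).trans ?_)
  refine ENNReal.ofReal_le_ofReal ?_
  rw [← inv_sq_pow_eq_exp (by linarith)]
  have hle : (tau d ^ 2)⁻¹ ^ k ≤ 1 := pow_le_one₀ (by positivity)
    (inv_le_one_of_one_le₀ (by nlinarith))
  calc _ ≤ Real.exp (-(1 / 8 * (tau d ^ 2)⁻¹ ^ k)) ^ (n / k) := by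
        gcongr
        · linarith
        · exact Real.one_sub_le_exp_neg _
    _ = _ := by
        rw [← Real.exp_nat_mul]
        congr 1
        ring

theorem exists_tailLaw_le_maxRun : ∃ C : ℝ, 0 ≤ C ∧ ∀ n k : ℕ, 1 ≤ k →
    tailLaw 0 {x | k ≤ maxRun n x} ≤
      ENNReal.ofReal (C * n * Real.exp (-(2 * Real.log Real.goldenRatio * k))) := by
  have hφ := Real.one_lt_goldenRatio
  have hsum : Summable fun d : ℕ => 1 / (d : ℝ) ^ 2 :=
    Real.summable_one_div_nat_pow.2 (by norm_num)
  have hsum' : Summable fun d : ℕ+ => 1 / ((d : ℕ) : ℝ) ^ 2 :=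
    hsum.comp_injective PNat.coe_injective
  refine ⟨8 * Real.goldenRatio ^ 2 * ∑' d : ℕ+, 1 / ((d : ℕ) : ℝ) ^ 2,
    by positivity, fun n k hk => ?_⟩
  have hsub : {x | k ≤ maxRun n x} ⊆ ⋃ d : ℕ+, {x | k ≤ longestRun n x d} := by
    intro x hx
    obtain ⟨d, hd⟩ := (isGreatest_maxRun n x).1
    refine mem_iUnion.2 ⟨d, ?_⟩
    simp only [mem_ofPred_eq] at hx hd ⊢
    rwa [hd]
  refine (measure_mono hsub).trans ((measure_iUnion_le _).trans ?_)
  rw [← inv_sq_pow_eq_exp (by linarith)]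
  -- One factor τ(d)⁻² ≤ d⁻² is set aside to make the sum over d converge; the others are bounded by
  -- φ⁻², at the cost of φ² in the constant.
  obtain ⟨k, rfl⟩ : ∃ l, k = l + 1 := ⟨k - 1, by omega⟩
  have hterm : ∀ d : ℕ+, tailLaw 0 {x | k + 1 ≤ longestRun n x d} ≤ ENNReal.ofReal
      (8 * n * (Real.goldenRatio ^ 2)⁻¹ ^ k * (1 / ((d : ℕ) : ℝ) ^ 2)) := by
    intro d
    have hd : 1 ≤ (d : ℕ) := d.2
    have hd' : (1 : ℝ) ≤ (d : ℕ) := by exact_mod_cast hd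
    refine (tailLaw_le_longestRun hd n (by omega)).trans (ENNReal.ofReal_le_ofReal ?_)
    rw [pow_succ, one_div, ← mul_assoc]
    have := le_tau d
    have := goldenRatio_le_tau hd
    gcongr
  refine (ENNReal.tsum_le_tsum hterm).trans_eq ?_
  rw [← ENNReal.ofReal_tsum_of_nonneg (fun d => by positivity) (hsum'.mul_left _), tsum_mul_left,
    pow_succ _ k]
  congr 1
  have hφ0 : Real.goldenRatio ≠ 0 := by linarith
  generalize Real.goldenRatio = φ at hφ0 ⊢
  field_simp

/-! ### Borel–Cantelli along powers of two -/

theorem ae_eventually_notMem_of_summable {Ω : Type*} [MeasurableSpace Ω] {ν : Measure Ω}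
    {S : ℕ → Set Ω} {b : ℕ → ℝ} (hb : Summable b)
    (h : ∀ᶠ m in atTop, ν (S m) ≤ ENNReal.ofReal (b m)) :
    ∀ᵐ x ∂ν, ∀ᶠ m in atTop, x ∉ S m := by
  obtain ⟨N, hN⟩ := eventually_atTop.1 h
  have hfin : ∑' m, ν (S (m + N)) ≠ ∞ :=
    ne_top_of_le_ne_top ((summable_nat_add_iff N).2 hb).tsum_ofReal_ne_top
      (ENNReal.tsum_le_tsum fun m => hN (m + N) (by omega))
  filter_upwards [ae_eventually_notMem hfin] with x hx
  obtain ⟨M, hM⟩ := eventually_atTop.1 hx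
  refine eventually_atTop.2 ⟨M + N, fun m hm => ?_⟩
  have := hM (m - N) (by omega)
  rwa [Nat.sub_add_cancel (by omega)] at this

theorem log_two_pow (m : ℕ) : Real.log ((2 : ℝ) ^ m) = m * Real.log 2 := Real.log_pow 2 m

theorem exp_neg_log_sub_log_log {m : ℕ} (hm : 1 ≤ m) (p : ℝ) :
    Real.exp (-(m * Real.log 2) - p * Real.log (m * Real.log 2)) =
      (Real.log 2) ^ (-p) * ((2 ^ m)⁻¹ * (m : ℝ) ^ (-p)) := by
  have hl : 0 < Real.log 2 := Real.log_pos one_lt_two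
  have hm' : (0 : ℝ) < m := by exact_mod_cast hm
  rw [sub_eq_add_neg, Real.exp_add, ← log_two_pow, Real.exp_neg, Real.exp_log (by positivity),
    log_two_pow, ← neg_mul, mul_comm (-p), ← Real.rpow_def_of_pos (by positivity),
    Real.mul_rpow hm'.le hl.le]
  ring

theorem eventually_two_pow_bracket {P : ℕ → Prop} (h : ∀ᶠ m in atTop, P m) :
    ∀ᶠ n : ℕ in atTop, ∃ m, 2 ≤ m ∧ P m ∧ 2 ^ m ≤ n ∧ n < 2 ^ (m + 1) := by
  obtain ⟨N, hN⟩ := eventually_atTop.1 h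
  filter_upwards [eventually_ge_atTop (2 ^ (N + 2))] with n hn
  have hn0 : n ≠ 0 := by have := Nat.two_pow_pos (N + 2); omega
  have hlog : N + 2 ≤ Nat.log 2 n := Nat.le_log_of_pow_le (by norm_num) hn
  exact ⟨Nat.log 2 n, by omega, hN _ (by omega), Nat.pow_log_le_self 2 hn0,
    Nat.lt_pow_succ_log_self (by norm_num) n⟩

theorem one_le_mul_log_two {m : ℕ} (hm : 2 ≤ m) : 1 ≤ m * Real.log 2 := by
  have hm' : (2 : ℝ) ≤ m := by exact_mod_cast hm
  nlinarith [Real.log_two_gt_d9]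

/-- Almost sure upper bound from an exponential tail estimate. -/
theorem ae_eventually_le_of_tail {Ω : Type*} [MeasurableSpace Ω] {ν : Measure Ω}
    {L : ℕ → Ω → ℕ} (hL : ∀ x, Monotone fun n => L n x) {β C c : ℝ} (hβ : 0 < β) (hC : 0 ≤ C)
    (hc : 1 / 2 < c)
    (h : ∀ n k : ℕ, 1 ≤ k → ν {x | k ≤ L n x} ≤
      ENNReal.ofReal (C * n * Real.exp (-(2 * β * k)))) :
    ∀ᵐ x ∂ν, ∀ᶠ n : ℕ in atTop,
      (L n x : ℝ) ≤ Real.log n / (2 * β) + c * Real.log (Real.log n) / β := by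
  -- The threshold at 2^m is tested against L at 2^(m+1), which covers every n between; this only
  -- costs a factor 2.
  set y : ℕ → ℝ := fun m => m * Real.log 2 / (2 * β) + c * Real.log (m * Real.log 2) / β with hy
  have hsum : Summable fun m : ℕ => 2 * C * (Real.log 2) ^ (-(2 * c)) * (m : ℝ) ^ (-(2 * c)) :=
    (Real.summable_nat_rpow.2 (by linarith)).mul_left _
  have hbound : ∀ᶠ m : ℕ in atTop, ν {x | ⌈y m⌉₊ ≤ L (2 ^ (m + 1)) x} ≤
      ENNReal.ofReal (2 * C * (Real.log 2) ^ (-(2 * c)) * (m : ℝ) ^ (-(2 * c))) := by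
    filter_upwards [eventually_ge_atTop 2] with m hm
    have h1 := one_le_mul_log_two hm
    have h2 := Real.log_nonneg h1
    have hypos : 0 < y m := by
      have : 0 ≤ c * Real.log (m * Real.log 2) / β :=
        div_nonneg (mul_nonneg (by linarith) h2) hβ.le
      have : 0 < m * Real.log 2 / (2 * β) := div_pos (by linarith) (by linarith)
      simp only [hy]
      linarith
    refine (h _ _ (Nat.ceil_pos.2 hypos)).trans (ENNReal.ofReal_le_ofReal ?_)
    have hexp : Real.exp (-(2 * β * ⌈y m⌉₊)) ≤
        (Real.log 2) ^ (-(2 * c)) * ((2 ^ m)⁻¹ * (m : ℝ) ^ (-(2 * c))) := by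
      rw [← exp_neg_log_sub_log_log (by omega)]
      refine Real.exp_le_exp.2 ?_
      have e : -(m * Real.log 2) - 2 * c * Real.log (m * Real.log 2) = -(2 * β * y m) := by
        simp only [hy]
        field_simp
        ring
      rw [e]
      have := Nat.le_ceil (y m)
      gcongr
    refine (mul_le_mul_of_nonneg_left hexp (by positivity)).trans_eq ?_
    push_cast
    rw [pow_succ]
    field_simp
  filter_upwards [ae_eventually_notMem_of_summable hsum hbound] with x hx
  filter_upwards [eventually_two_pow_bracket hx] with n hn
  obtain ⟨m, hm, hxm, hmn, hnm⟩ := hn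
  have hlt : (L (2 ^ (m + 1)) x : ℝ) < y m := Nat.lt_ceil.1 (not_le.1 hxm)
  have hle : (L n x : ℝ) ≤ L (2 ^ (m + 1)) x := by exact_mod_cast hL x hnm.le
  have h1 := one_le_mul_log_two hm
  have hmn' : (2 : ℝ) ^ m ≤ n := by exact_mod_cast hmn
  have hlog : m * Real.log 2 ≤ Real.log n := by
    rw [← log_two_pow]
    exact Real.log_le_log (by positivity) hmn'
  have hloglog : Real.log (m * Real.log 2) ≤ Real.log (Real.log n) :=
    Real.log_le_log (by linarith) hlog
  calc (L n x : ℝ) ≤ y m := hle.trans hlt.le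
    _ ≤ _ := by
      simp only [hy]
      have hc0 : 0 ≤ c := by linarith
      gcongr

theorem summable_exp_neg_mul_rpow {K p : ℝ} (hK : 0 < K) (hp : 0 < p) :
    Summable fun m : ℕ => Real.exp (-(K * (m : ℝ) ^ p)) := by
  have h1 : Tendsto (fun m : ℕ => (m : ℝ) ^ p) atTop atTop :=
    (tendsto_rpow_atTop hp).comp tendsto_natCast_atTop_atTop
  -- The exponent -2/p turns (m^p)^(-2/p) into the summable m⁻².
  have h2 := (isLittleO_exp_neg_mul_rpow_atTop hK (-2 / p)).comp_tendsto h1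
  refine summable_of_isBigO_nat (g := fun m : ℕ => (m : ℝ) ^ (-2 : ℝ))
    (Real.summable_nat_rpow.2 (by norm_num)) ?_
  refine h2.isBigO.congr (fun m => ?_) fun m => ?_
  · simp only [Function.comp, neg_mul]
  · simp only [Function.comp]
    rw [← Real.rpow_mul (Nat.cast_nonneg m)]
    congr 1
    field_simp

/-- Almost sure lower bound from a block estimate. -/
theorem ae_eventually_ge_of_blocks {Ω : Type*} [MeasurableSpace Ω] {ν : Measure Ω}
    {L : ℕ → Ω → ℕ} (hL : ∀ x, Monotone fun n => L n x) {β δ c : ℝ} (hβ : 0 < β) (hδ : 0 < δ)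
    (hc : 1 / 2 < c)
    (h : ∀ n k : ℕ, ν {x | L n x < k} ≤
      ENNReal.ofReal (Real.exp (-(δ * Real.exp (-(2 * β * k)) * (n / k : ℕ))))) :
    ∀ᵐ x ∂ν, ∀ᶠ n : ℕ in atTop,
      Real.log n / (2 * β) - c * Real.log (Real.log n) / β ≤ L n x := by
  -- Using m + 1 in the main term and m in the correction makes y m dominate the lower threshold at
  -- every n in [2^m, 2^(m+1)).
  set y : ℕ → ℝ := fun m =>
    (m + 1) * Real.log 2 / (2 * β) - c * Real.log (m * Real.log 2) / β with hy
  set A : ℝ := Real.log 2 / β + 1 with hA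
  have hl : 0 < Real.log 2 := Real.log_pos one_lt_two
  have hA0 : 0 < A := by positivity
  set K : ℝ := δ * Real.exp (-(2 * β)) * (Real.log 2) ^ (2 * c) / (4 * A) with hK
  have hK0 : 0 < K := by positivity
  have hsum := summable_exp_neg_mul_rpow hK0 (p := 2 * c - 1) (by linarith)
  -- Since k ≤ A m, this gives 2k ≤ 2^m, so rounding down 2^m / k loses at most a factor 2.
  have hgrow : ∀ᶠ m : ℕ in atTop, 2 * A * m ≤ 2 ^ m := by
    have ht : Tendsto (fun m : ℕ => (m : ℝ) ^ 1 / 2 ^ m) atTop (𝓝 0) :=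
      tendsto_pow_const_div_const_pow_of_one_lt 1 one_lt_two
    filter_upwards [ht.eventually_le_const (u := 1 / (2 * A)) (by positivity)] with m hm
    rw [div_le_div_iff₀ (by positivity) (by positivity)] at hm
    linarith
  have hbound : ∀ᶠ m : ℕ in atTop, ν {x | L (2 ^ m) x < ⌈y m⌉₊} ≤
      ENNReal.ofReal (Real.exp (-(K * (m : ℝ) ^ (2 * c - 1)))) := by
    filter_upwards [eventually_ge_atTop 2, hgrow] with m hm hmA
    have hm' : (2 : ℝ) ≤ m := by exact_mod_cast hm
    have hm0 : (0 : ℝ) < m := by linarith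
    rcases Nat.eq_zero_or_pos ⌈y m⌉₊ with h0 | hk
    · simp [h0]
    refine (h _ _).trans (ENNReal.ofReal_le_ofReal (Real.exp_le_exp.2 (neg_le_neg ?_)))
    have hy0 : 0 < y m := Nat.ceil_pos.1 hk
    have hceil : (⌈y m⌉₊ : ℝ) < y m + 1 := Nat.ceil_lt_add_one hy0.le
    set k := ⌈y m⌉₊
    have hk' : (0 : ℝ) < k := by exact_mod_cast hk
    have hkA : (k : ℝ) ≤ A * m := by
      have h2 := Real.log_nonneg (one_le_mul_log_two hm)
      have h3 : 0 ≤ c * Real.log (m * Real.log 2) / β :=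
        div_nonneg (mul_nonneg (by linarith) h2) hβ.le
      have h4 : y m ≤ m * (Real.log 2 / β) := by
        calc y m ≤ (m + 1) * Real.log 2 / (2 * β) := by simp only [hy]; linarith
          _ ≤ (m + m) * Real.log 2 / (2 * β) := by gcongr; linarith
          _ = _ := by field_simp; ring
      rw [hA]
      linarith
    have hdiv : (2 : ℝ) ^ m / (2 * (A * m)) ≤ ((2 ^ m / k : ℕ) : ℝ) := by
      have h1 : (2 : ℝ) ^ m / k < ((2 ^ m / k : ℕ) : ℝ) + 1 := by
        have := Nat.lt_floor_add_one ((2 : ℝ) ^ m / k)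
        have e : ⌊(2 : ℝ) ^ m / k⌋₊ = 2 ^ m / k := by
          have := Nat.floor_div_eq_div (K := ℝ) (2 ^ m) k
          push_cast at this
          exact this
        rwa [e] at this
      have h2 : (1 : ℝ) ≤ 2 ^ m / (2 * k) := by
        rw [le_div_iff₀ (by positivity)]; linarith
      have h3 : (2 : ℝ) ^ m / k = 2 ^ m / (2 * k) + 2 ^ m / (2 * k) := by field_simp; ring
      have h4 : (2 : ℝ) ^ m / (2 * (A * m)) ≤ 2 ^ m / (2 * k) := by gcongr
      linarith
    -- The ceiling costs exp(-2β), and m + 1 in place of m costs the factor 1/2.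
    have hexp : Real.exp (-(2 * β)) *
        ((Real.log 2) ^ (2 * c) * ((2 ^ m)⁻¹ * (m : ℝ) ^ (2 * c)) / 2) ≤
          Real.exp (-(2 * β * k)) := by
      have e := exp_neg_log_sub_log_log (m := m) (by omega) (-(2 * c))
      rw [neg_neg] at e
      have e2 : (2 : ℝ)⁻¹ = Real.exp (-Real.log 2) := by
        rw [Real.exp_neg, Real.exp_log two_pos]
      rw [← e, div_eq_mul_inv, e2, ← Real.exp_add, ← Real.exp_add]
      refine Real.exp_le_exp.2 ?_
      have e3 : -(2 * β) + (-(m * Real.log 2) - -(2 * c) * Real.log (m * Real.log 2) +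
          -Real.log 2) = -(2 * β * (y m + 1)) := by
        simp only [hy]
        field_simp
        ring
      rw [e3]
      gcongr
    calc K * (m : ℝ) ^ (2 * c - 1)
        = δ * (Real.exp (-(2 * β)) *
            ((Real.log 2) ^ (2 * c) * ((2 ^ m)⁻¹ * (m : ℝ) ^ (2 * c)) / 2)) *
              (2 ^ m / (2 * (A * m))) := by
          rw [hK, Real.rpow_sub_one hm0.ne']
          field_simp
          norm_num
      _ ≤ _ := by gcongr
  filter_upwards [ae_eventually_notMem_of_summable hsum hbound] with x hx
  filter_upwards [eventually_two_pow_bracket hx] with n hn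
  obtain ⟨m, hm, hxm, hmn, hnm⟩ := hn
  have hlt : y m ≤ L (2 ^ m) x := Nat.ceil_le.1 (not_lt.1 hxm)
  have hle : (L (2 ^ m) x : ℝ) ≤ L n x := by exact_mod_cast hL x hmn
  have h1 := one_le_mul_log_two hm
  have hmn' : (2 : ℝ) ^ m ≤ n := by exact_mod_cast hmn
  have hnm' : (n : ℝ) ≤ 2 ^ (m + 1) := by exact_mod_cast hnm.le
  have hlog : m * Real.log 2 ≤ Real.log n := by
    rw [← log_two_pow]
    exact Real.log_le_log (by positivity) hmn'
  have hlog' : Real.log n ≤ (m + 1) * Real.log 2 := by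
    have := Real.log_le_log (lt_of_lt_of_le (by positivity) hmn') hnm'
    rw [log_two_pow] at this
    exact_mod_cast this
  have hloglog : Real.log (m * Real.log 2) ≤ Real.log (Real.log n) :=
    Real.log_le_log (by linarith) hlog
  refine le_trans ?_ (hlt.trans hle)
  simp only [hy]
  have hc0 : 0 ≤ c := by linarith
  gcongr

/-! ### Almost sure asymptotics under the Gauss measure -/

theorem gaussMeasure_absolutelyContinuous : gaussMeasure ≪ tailLaw 0 := by
  refine (withDensity_absolutelyContinuous _ _).trans ?_
  have h : tailLaw 0 = volume.restrict (Ioo 0 1) := by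
    simp [tailLaw, tailDensity]
  rw [h]
  refine (Measure.restrict_mono_set _ fun x hx => ?_).absolutelyContinuous
  exact ⟨lt_of_le_of_ne hx.1.1 fun h => hx.2 ⟨0, by simpa using h⟩, hx.1.2⟩

theorem ae_eventually_abs_longestRun_sub_le {c : ℝ} (hc : 1 / 2 < c) {d : ℕ} (hd : 1 ≤ d) :
    ∀ᵐ x ∂(tailLaw 0), ∀ᶠ n : ℕ in atTop,
      |(longestRun n x d : ℝ) - Real.log n / (2 * Real.log (tau d))|
        ≤ c * Real.log (Real.log n) / Real.log (tau d) := by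
  have ht := one_lt_tau hd
  have hβ := Real.log_pos ht
  filter_upwards [ae_eventually_le_of_tail (fun x => longestRun_mono x d) hβ
      (by norm_num : (0 : ℝ) ≤ 8) hc fun n k hk => by
        rw [← inv_sq_pow_eq_exp (by linarith)]; exact tailLaw_le_longestRun hd n hk,
    ae_eventually_ge_of_blocks (fun x => longestRun_mono x d) hβ (by norm_num) hc
      (tailLaw_longestRun_lt hd)] with x h1 h2
  filter_upwards [h1, h2] with n h1 h2
  rw [abs_le]
  constructor <;> linarith

theorem ae_eventually_abs_maxRun_sub_le {c : ℝ} (hc : 1 / 2 < c) :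
    ∀ᵐ x ∂(tailLaw 0), ∀ᶠ n : ℕ in atTop,
      |(maxRun n x : ℝ) - Real.log n / (2 * Real.log Real.goldenRatio)|
        ≤ c * Real.log (Real.log n) / Real.log Real.goldenRatio := by
  obtain ⟨C, hC, hmax⟩ := exists_tailLaw_le_maxRun
  filter_upwards [ae_eventually_le_of_tail maxRun_mono
      (Real.log_pos Real.one_lt_goldenRatio) hC hc hmax,
    ae_eventually_abs_longestRun_sub_le hc le_rfl] with x h1 h2
  filter_upwards [h1, h2] with n h1 h2
  rw [tau_one] at h2
  have h3 : (longestRun n x 1 : ℝ) ≤ maxRun n x := by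
    exact_mod_cast longestRun_le_maxRun n x le_rfl
  rw [abs_le] at h2 ⊢
  constructor <;> linarith

end CFRuns

theorem theorem2 (c : ℝ) (hc : 1 / 2 < c) :
    ∀ᵐ x ∂CFRuns.gaussMeasure,
      (∀ d : ℕ, 1 ≤ d → ∃ N : ℕ, ∀ n : ℕ, N ≤ n →
        |(CFRuns.longestRun n x d : ℝ) - Real.log n / (2 * Real.log (CFRuns.tau d))|
          ≤ c * Real.log (Real.log n) / Real.log (CFRuns.tau d)) ∧
      (∃ N : ℕ, ∀ n : ℕ, N ≤ n →
        |(CFRuns.maxRun n x : ℝ) - Real.log n / (2 * Real.log Real.goldenRatio)|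
          ≤ c * Real.log (Real.log n) / Real.log Real.goldenRatio) := by
  refine CFRuns.gaussMeasure_absolutelyContinuous.ae_le ?_
  have hrun : ∀ᵐ x ∂(CFRuns.tailLaw 0), ∀ d : ℕ, 1 ≤ d → ∀ᶠ n : ℕ in Filter.atTop,
      |(CFRuns.longestRun n x d : ℝ) - Real.log n / (2 * Real.log (CFRuns.tau d))|
        ≤ c * Real.log (Real.log n) / Real.log (CFRuns.tau d) :=
    ae_all_iff.2 fun d => Filter.eventually_imp_distrib_left.2 fun hd =>
      CFRuns.ae_eventually_abs_longestRun_sub_le hc hd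
  filter_upwards [hrun, CFRuns.ae_eventually_abs_maxRun_sub_le hc] with x h1 h2
  exact ⟨fun d hd => Filter.eventually_atTop.1 (h1 d hd), Filter.eventually_atTop.1 h2⟩
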